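/- Let $\omega=\sqrt{2-\sqrt2}$ and $T_1=2\pi/\omega$, let $p,q$ be relatively prime positive integers, and let $F_1,F_2:\mathbb R\times\mathbb R^4\to\mathbb R$ be functions of class $C^2$ (in particular, smooth functions are allowed) that are periodic of period $pT_1/q$ in the first variable $\tau$. Consider the perturbed double pendulum $$\theta_1''=-2\theta_1+\theta_2+\varepsilon F_1(\tau,\theta_1,\theta_1',\theta_2,\theta_2'),\qquad \theta_2''=2\theta_1-2\theta_2+\varepsilon F_2(\tau,\theta_1,\theta_1',\theta_2,\theta_2'). \tag{1}$$ For $(X_0,Y_0)\in\mathbb R^2$ put $$A(\tau)=\tfrac{1}{\sqrt{4-2\sqrt2}}\,(X_0\cos\omega\tau+Y_0\sin\omega\tau),\qquad B(\tau)=\tfrac1{\sqrt2}\,(Y_0\cos\omega\tau-X_0\sin\omega\tau),$$ $$C(\tau)=\tfrac{1}{\sqrt{2-\sqrt2}}\,(X_0\cos\omega\tau+Y_0\sin\omega\tau),\qquad D(\tau)=Y_0\cos\omega\tau-X_0\sin\omega\tau,$$ $\bar F_k(\tau)=F_k(\tau,A(\tau),B(\tau),C(\tau),D(\tau))$ for $k=1,2$,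 and $$\mathcal G_1(X_0,Y_0)=\int_0^{pT_1}\sin(\omega\tau)\,(\sqrt2\,\bar F_1+\bar F_2)\,d\tau,\qquad \mathcal G_2(X_0,Y_0)=\int_0^{pT_1}\cos(\omega\tau)\,(\sqrt2\,\bar F_1+\bar F_2)\,d\tau .$$ Let $(X_0^*,Y_0^*)\neq(0,0)$ be a simple zero of the system $\mathcal G_1=\mathcal G_2=0$, that is, a zero at which the Jacobian determinant $\det\,\partial(\mathcal G_1,\mathcal G_2)/\partial(X_0,Y_0)$ is non-zero, and let $A,B,C,D$ be the functions above for $(X_0,Y_0)=(X_0^*,Y_0^*)$. Then $(\theta_1,\theta_2)=(A,C)$ is a periodic solution, with minimal period $T_1$, of the unperturbed double pendulum ($\varepsilon=0$ in (1)), and there is $\varepsilon_0>0$ such that for every $\varepsilon$ with $0<|\varepsilon|<\varepsilon_0$ system (1) has a $pT_1$-periodic solution $(\theta_1(\cdot,\varepsilon),\theta_2(\cdot,\varepsilon))$, defined on all of $\mathbb R$, such that as $\varepsilon\to0$ this solution tends to the unperturbed periodic solution $(A,C)$ run $p$ times: in the phase space, $$(\theta_1,\theta_1',\theta_2,\theta_2')(\tau,\varepsilon)\longrightarrow(A,B,C,D)(\tau)\qquad\text{uniformly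 in }\tau\in\mathbb R .$$ -/

import Mathlib

open Topology Filter

namespace DoublePendulum

/-- The smaller frequency `√(2 - √2)` of the unperturbed double pendulum. -/
noncomputable def freq : ℝ := √(2 - √2)

/-- The period `T₁ = 2π / √(2 - √2)` of the slow mode. -/
noncomputable def slowPeriod : ℝ := 2 * Real.pi / √(2 - √2)

/-- `(θ₁, θ₂)` is a solution, defined for all times, of the perturbed double pendulum
`θ₁'' = -2 θ₁ + θ₂ + ε F₁(τ, θ₁, θ₁', θ₂, θ₂')`, `θ₂'' = 2 θ₁ - 2 θ₂ + ε F₂(τ, θ₁, θ₁', θ₂, θ₂')`.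
For `ε = 0` this is the unperturbed double pendulum. -/
structure IsSolution (F₁ F₂ : ℝ × ℝ × ℝ × ℝ × ℝ → ℝ) (ε : ℝ) (θ₁ θ₂ : ℝ → ℝ) : Prop where
  differentiable₁ : Differentiable ℝ θ₁
  differentiable₂ : Differentiable ℝ θ₂
  eq₁ : ∀ τ, HasDerivAt (deriv θ₁)
    (-2 * θ₁ τ + θ₂ τ + ε * F₁ (τ, θ₁ τ, deriv θ₁ τ, θ₂ τ, deriv θ₂ τ)) τ
  eq₂ : ∀ τ, HasDerivAt (deriv θ₂)
    (2 * θ₁ τ - 2 * θ₂ τ + ε * F₂ (τ, θ₁ τ, deriv θ₁ τ, θ₂ τ, deriv θ₂ τ)) τ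

/-- First angle of the slow mode with parameters `X`, `Y`. -/
noncomputable def A (X Y τ : ℝ) : ℝ :=
  1 / √(4 - 2 * √2) * (X * Real.cos (freq * τ) + Y * Real.sin (freq * τ))

/-- First angular velocity of the slow mode. -/
noncomputable def B (X Y τ : ℝ) : ℝ :=
  1 / √2 * (Y * Real.cos (freq * τ) - X * Real.sin (freq * τ))

/-- Second angle of the slow mode. -/
noncomputable def C (X Y τ : ℝ) : ℝ :=
  1 / √(2 - √2) * (X * Real.cos (freq * τ) + Y * Real.sin (freq * τ))

/-- Second angular velocity of the slow mode. -/
noncomputable def D (X Y τ : ℝ) : ℝ :=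
  Y * Real.cos (freq * τ) - X * Real.sin (freq * τ)

/-- A function of `(τ, θ₁, θ₁', θ₂, θ₂')` evaluated along the slow mode. -/
noncomputable def along (F : ℝ × ℝ × ℝ × ℝ × ℝ → ℝ) (X Y τ : ℝ) : ℝ :=
  F (τ, A X Y τ, B X Y τ, C X Y τ, D X Y τ)

/-- The averaged function `𝒢₁`. -/
noncomputable def G₁ (F₁ F₂ : ℝ × ℝ × ℝ × ℝ × ℝ → ℝ) (p : ℕ) (X Y : ℝ) : ℝ :=
  ∫ τ in (0 : ℝ)..(p * slowPeriod),
    Real.sin (freq * τ) * (√2 * along F₁ X Y τ + along F₂ X Y τ)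

/-- The averaged function `𝒢₂`. -/
noncomputable def G₂ (F₁ F₂ : ℝ × ℝ × ℝ × ℝ × ℝ → ℝ) (p : ℕ) (X Y : ℝ) : ℝ :=
  ∫ τ in (0 : ℝ)..(p * slowPeriod),
    Real.cos (freq * τ) * (√2 * along F₁ X Y τ + along F₂ X Y τ)

/-- `(X, Y)` is a simple zero of `𝒢₁ = 𝒢₂ = 0`: a zero at which the Jacobian determinant
`det ∂(𝒢₁, 𝒢₂)/∂(X₀, Y₀)` does not vanish. -/
def IsSimpleZero (F₁ F₂ : ℝ × ℝ × ℝ × ℝ × ℝ → ℝ) (p : ℕ) (X Y : ℝ) : Prop :=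
  G₁ F₁ F₂ p X Y = 0 ∧ G₂ F₁ F₂ p X Y = 0 ∧
    (fderiv ℝ (fun P : ℝ × ℝ => (G₁ F₁ F₂ p P.1 P.2, G₂ F₁ F₂ p P.1 P.2)) (X, Y)).det ≠ 0

end DoublePendulum

/-! The linear pendulum splits into two oscillators along the eigenvectors `(1, √2)` and `(-1, √2)`,
with frequencies `freq` and `fastFreq = (1 + √2) * freq`. Using the amplitudes of both modes as
unknowns (variation of constants) turns the system into `Φ' = ε • ampField t Φ`, so for `ε = 0`
every constant is a solution.

Put `T = p T₁`. A trajectory closes up after time `T` iff the slow amplitudes return to their values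
and the fast ones are rotated by the angle `fastFreq * T`. Since `(1 + √2) p` is irrational, this
rotation `R` is not the identity and `S = R - 1` is invertible (`cos_fastFreq_ne_one`,
`rotationSubId_bijective`): the fast mode is nonresonant and contributes no bifurcation equation.
The slow condition reads `ε ∫ (slow part of ampField) = 0`; dividing by `ε` leaves an equation that
at `ε = 0`, on constants `(x, 0)`, is `𝒢₁ = 𝒢₂ = 0` up to constant factors
(`integral_ampField_fst`).

`exists_amplitudes` solves the integral equation and both boundary conditions together by the
implicit function theorem in `C([0, T], V₁ × V₂)`, with no flow map and no global existence theorem.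
Simplicity of the zero makes the linearization invertible (`isInvertible_linearization`). The
solution on `[0, T]` is then extended periodically (`exists_periodic_extension`), and convergence in
the sup norm gives the uniform limit. -/

namespace DoublePendulum

/-! ### Differentiability of superposition operators on continuous functions. -/

section

variable {I V W : Type*} [TopologicalSpace I] [TopologicalSpace V] [TopologicalSpace W]

/-- The superposition operator `Φ ↦ (t ↦ K t (Φ t))`. -/
def superposition (K : I → V → W) (hK : Continuous (Function.uncurry K)) (Φ : C(I, V)) :
    C(I, W) :=
  ⟨fun t => K t (Φ t), hK.comp (continuous_id.prodMk Φ.continuous)⟩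

end

section Superposition

variable {I V W : Type*} [TopologicalSpace I] [CompactSpace I]
  [NormedAddCommGroup V] [NormedSpace ℝ V] [NormedAddCommGroup W] [NormedSpace ℝ W]

/-- Pointwise application of a continuous family of operators to a continuous function. -/
noncomputable def pointwiseApply (Q : C(I, V →L[ℝ] W)) : C(I, V) →L[ℝ] C(I, W) :=
  LinearMap.mkContinuous
    { toFun := fun δ => ⟨fun t => Q t (δ t), by fun_prop⟩
      map_add' := fun _ _ => by ext; simp
      map_smul' := fun _ _ => by ext; simp } ‖Q‖ (fun δ => by
      rw [ContinuousMap.norm_le _ (by positivity)]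
      intro t
      exact ((Q t).le_opNorm _).trans
        (mul_le_mul (Q.norm_coe_le_norm t) (δ.norm_coe_le_norm t) (norm_nonneg _) (norm_nonneg Q)))

/-- Compactness of `I` makes `K'` near the graph of `Φ` uniformly close to its values on the graph;
the mean value inequality, applied for each `t`, then yields strict differentiability in the sup
norm. -/
theorem hasStrictFDerivAt_superposition (K : I → V → W) (K' : I → V → V →L[ℝ] W)
    (hK : Continuous (Function.uncurry K)) (hK' : Continuous (Function.uncurry K'))
    (hd : ∀ t x, HasFDerivAt (K t) (K' t x) x) (Φ : C(I, V)) :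
    HasStrictFDerivAt (superposition K hK) (pointwiseApply (superposition K' hK' Φ)) Φ := by
  refine .of_isLittleO ?_
  rw [Asymptotics.isLittleO_iff]
  intro c hc
  -- The tube lemma over the compact `I`: one radius serves all `t`, without local compactness of
  -- `V`.
  have h1 : ∀ᶠ h in 𝓝 (0 : V), ∀ t ∈ (Set.univ : Set I),
      ‖K' t (Φ t + h) - K' t (Φ t)‖ < c := by
    refine isCompact_univ.eventually_forall_of_forall_eventually ?_
    intro t _
    have hcont : Continuous fun z : V × I =>
        ‖K' z.2 (Φ z.2 + z.1) - K' z.2 (Φ z.2)‖ := by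
      have e1 : Continuous fun z : V × I => K' z.2 (Φ z.2 + z.1) :=
        hK'.comp (f := fun z : V × I => (z.2, Φ z.2 + z.1)) (by fun_prop)
      have e2 : Continuous fun z : V × I => K' z.2 (Φ z.2) :=
        hK'.comp (f := fun z : V × I => (z.2, Φ z.2)) (by fun_prop)
      exact (e1.sub e2).norm
    exact hcont.continuousAt.eventually_lt continuousAt_const (by simpa using hc)
  obtain ⟨r, hr, hball⟩ := Metric.eventually_nhds_iff_ball.1 h1
  have h2 : ∀ᶠ z : C(I, V) × C(I, V) in 𝓝 (Φ, Φ), dist z.1 Φ < r ∧ dist z.2 Φ < r := by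
    have : Metric.ball (Φ, Φ) r ∈ 𝓝 (Φ, Φ) := Metric.ball_mem_nhds _ hr
    filter_upwards [this] with z hz
    rw [Metric.mem_ball, Prod.dist_eq, max_lt_iff] at hz
    exact hz
  filter_upwards [h2] with z hz
  rw [ContinuousMap.norm_le _ (by positivity)]
  intro t
  have hmem : ∀ Ψ : C(I, V), dist Ψ Φ < r → Ψ t ∈ Metric.ball (Φ t) r := fun Ψ hΨ =>
    (ContinuousMap.dist_apply_le_dist t).trans_lt hΨ
  have h3 := (convex_ball (Φ t) r).norm_image_sub_le_of_norm_hasFDerivWithin_le'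
    (f := K t) (f' := K' t) (φ := K' t (Φ t)) (C := c)
    (fun x _ => (hd t x).hasFDerivWithinAt) (fun x hx => by
      have := hball (x - Φ t) (by simpa [dist_eq_norm] using hx) t trivial
      rw [add_sub_cancel] at this
      exact this.le) (hmem z.2 hz.2) (hmem z.1 hz.1)
  refine h3.trans ?_
  gcongr
  exact (z.1 - z.2).norm_coe_le_norm t

end Superposition

/-! ### The Volterra operator. -/

section Primitive

variable {V : Type*} [NormedAddCommGroup V] [NormedSpace ℝ V]

/-- The Volterra operator: primitives vanishing at `0` on the interval `[0, T]`. -/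
noncomputable def primitive (T : ℝ) (hT : 0 ≤ T) :
    C(Set.Icc 0 T, V) →L[ℝ] C(Set.Icc 0 T, V) :=
  have hi : ∀ (g : C(Set.Icc 0 T, V)) (a b : ℝ),
      IntervalIntegrable (fun s => g (Set.projIcc 0 T hT s)) MeasureTheory.volume a b := fun g a b =>
    (g.continuous.comp continuous_projIcc).intervalIntegrable a b
  LinearMap.mkContinuous
    { toFun := fun g => ⟨fun t => ∫ s in (0 : ℝ)..t, g (Set.projIcc 0 T hT s),
        (intervalIntegral.continuous_primitive (hi g) 0).comp continuous_subtype_val⟩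
      map_add' := fun f g => by
        ext t
        exact intervalIntegral.integral_add (hi f 0 t) (hi g 0 t)
      map_smul' := fun c g => by
        ext t
        exact intervalIntegral.integral_smul c _ } T (fun g => by
      rw [ContinuousMap.norm_le _ (by positivity)]
      intro t
      have := intervalIntegral.norm_integral_le_of_norm_le_const (a := 0) (b := t.1)
        (f := fun s => g (Set.projIcc 0 T hT s)) (C := ‖g‖) (fun s _ => g.norm_coe_le_norm _)
      refine this.trans ?_
      rw [sub_zero, abs_of_nonneg t.2.1, mul_comm]
      gcongr
      exact t.2.2)

end Primitive

/-! ### Periodic extension of solutions. -/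

section PeriodicExtension

variable {V : Type*} [NormedAddCommGroup V] [NormedSpace ℝ V] [CompleteSpace V]

/-- A solution on `[0, T]` of a `T`-periodic equation whose values at `0` and `T` agree extends to
a `T`-periodic solution on the line. -/
theorem exists_periodic_extension {T : ℝ} (hT : 0 < T) {f : ℝ → V → V}
    (hf : Continuous (Function.uncurry f)) (hper : ∀ t x, f (t + T) x = f t x) {x : ℝ → V}
    (hx : ∀ t ∈ Set.Icc 0 T, HasDerivAt x (f t (x t)) t) (h0 : x 0 = x T) :
    ∃ y : ℝ → V, Function.Periodic y T ∧ (∀ t, HasDerivAt y (f t (y t)) t) ∧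
      ∀ t ∈ Set.Icc 0 T, y t = x t := by
  have : Fact (0 < T) := ⟨hT⟩
  have hxc : ContinuousOn x (Set.Icc 0 T) := fun t ht =>
    (hx t ht).continuousAt.continuousWithinAt
  let Y : AddCircle T → V := AddCircle.liftIco T 0 x
  have hY : Continuous Y := AddCircle.liftIco_continuous (by simpa using h0) (by simpa using hxc)
  let y : ℝ → V := fun t => Y t
  have hyc : Continuous y := hY.comp (AddCircle.continuous_mk' T)
  have hyp : Function.Periodic y T := fun t => by simp [y]
  have hyx : ∀ t ∈ Set.Icc 0 T, y t = x t := by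
    intro t ht
    rcases eq_or_lt_of_le ht.2 with h | h
    · have e1 : y T = y 0 := by simpa using hyp 0
      rw [h, e1, ← h0]
      exact AddCircle.liftIco_coe_apply (by simpa using hT)
    · exact AddCircle.liftIco_coe_apply (by simpa using ⟨ht.1, h⟩)
  let g : ℝ → V := fun t => f t (y t)
  have hgc : Continuous g := hf.comp (continuous_id.prodMk hyc)
  have hgp : Function.Periodic g T := fun t => by simp only [g, hyp t, hper]
  have hgi : ∀ a b, IntervalIntegrable g MeasureTheory.volume a b := fun a b =>
    hgc.intervalIntegrable a b
  have hint : ∀ t ∈ Set.Icc 0 T, y t = y 0 + ∫ s in (0 : ℝ)..t, g s := by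
    intro t ht
    have := intervalIntegral.integral_eq_sub_of_hasDerivAt (a := 0) (b := t) (f := x) (f' := g)
      (fun s hs => by
        rw [Set.uIcc_of_le ht.1] at hs
        have hs' : s ∈ Set.Icc 0 T := ⟨hs.1, hs.2.trans ht.2⟩
        simpa only [g, hyx s hs'] using hx s hs') (hgi 0 t)
    rw [this, hyx t ht, hyx 0 ⟨le_rfl, hT.le⟩, add_sub_cancel]
  -- Equal end values mean that `g` has mean zero, so its primitive is periodic.
  have hint0 : ∫ s in (0 : ℝ)..T, g s = 0 := by
    have e1 := hint T ⟨hT.le, le_rfl⟩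
    have e2 : y T = y 0 := by simpa using hyp 0
    rw [e2] at e1
    simpa using e1
  have hpp : Function.Periodic (fun t => y 0 + ∫ s in (0 : ℝ)..t, g s) T := by
    intro t
    have := hgp.intervalIntegral_add_eq_add 0 t hgi
    simp only [zero_add] at this
    simp [this, hint0]
  -- Both sides are `T`-periodic and agree on one period. Differentiating the integral equation then
  -- avoids gluing derivatives at multiples of `T`.
  have hall : ∀ t, y t = y 0 + ∫ s in (0 : ℝ)..t, g s := by
    intro t
    obtain ⟨s, hs, hst⟩ := hyp.sub (c := T) hpp |>.exists_mem_Ico₀ hT t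
    have := hint s ⟨hs.1, hs.2.le⟩
    rw [← sub_eq_zero] at this ⊢
    exact hst.trans this
  refine ⟨y, hyp, fun t => ?_, hyx⟩
  have := (hgc.integral_hasStrictDerivAt 0 t).hasDerivAt.const_add (y 0)
  rwa [← funext hall] at this

end PeriodicExtension

end DoublePendulum

namespace DoublePendulum

/-! ### Implicit function theorem for the boundary value problem. -/

section Averaging

/-- Constant functions, as a continuous linear map. -/
def constCLM (I V : Type*) [TopologicalSpace I] [CompactSpace I] [NormedAddCommGroup V]
    [NormedSpace ℝ V] : V →L[ℝ] C(I, V) where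
  toFun := ContinuousMap.const I
  map_add' _ _ := rfl
  map_smul' _ _ := rfl
  cont := ContinuousMap.continuous_const'

@[simp] lemma constCLM_apply {I V : Type*} [TopologicalSpace I] [CompactSpace I]
    [NormedAddCommGroup V] [NormedSpace ℝ V] (v : V) (t : I) : constCLM I V v t = v := rfl

variable {V₁ V₂ : Type*} [NormedAddCommGroup V₁] [NormedSpace ℝ V₁] [CompleteSpace V₁]
  [NormedAddCommGroup V₂] [NormedSpace ℝ V₂] [CompleteSpace V₂]

/-- The linearization of the periodicity problem is invertible: here `R` is the derivative of
`Φ ↦ ∫ K₁(s, Φ(s)) ds`. -/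
theorem isInvertible_linearization {I : Type*} [TopologicalSpace I] [CompactSpace I] (o : I)
    (M : C(I, V₁ × V₂) →L[ℝ] C(I, V₁ × V₂)) (R : C(I, V₁ × V₂) →L[ℝ] V₁) (S : V₂ →L[ℝ] V₂)
    (hS : Function.Bijective S) (L : V₁ →L[ℝ] V₁) (hL : Function.Bijective L)
    (hRL : ∀ v, R (constCLM I _ (v, 0)) = L v)
    (hM : ∀ δ, M δ = δ - constCLM I _ (δ o) + constCLM I _ (R δ, S (δ o).2)) :
    M.IsInvertible := by
  -- Evaluation at `o` isolates the boundary terms; once these vanish, a kernel element is constant,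
  -- and `S` and `L` annihilate only the constant zero.
  have hinj : M.ker = ⊥ := by
    refine LinearMap.ker_eq_bot'.2 fun δ hδ => ?_
    have h1 : M δ = 0 := hδ
    rw [hM] at h1
    have h2 : (R δ, S (δ o).2) = 0 := by simpa using congrArg (fun g : C(I, V₁ × V₂) => g o) h1
    rw [h2, map_zero, add_zero, sub_eq_zero] at h1
    have h3 : (δ o).2 = 0 := hS.1 (by simpa using congrArg Prod.snd h2)
    have h4 : δ o = ((δ o).1, 0) := Prod.ext rfl h3
    have h5 : L (δ o).1 = 0 := by
      rw [← hRL, ← h4, ← h1]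
      exact congrArg Prod.fst h2
    have h6 : (δ o).1 = 0 := hL.1 (by simpa using h5)
    rw [h1, h4, h6]
    exact map_zero _
  have hsurj : M.range = ⊤ := by
    refine LinearMap.range_eq_top.2 fun η => ?_
    -- A solution must be `η - η(o)` plus a constant: `S` determines the second component of that
    -- constant, then `L` the first.
    obtain ⟨v₂, hv₂⟩ := hS.2 (η o).2
    obtain ⟨v₁, hv₁⟩ := hL.2 ((η o).1 - R (η - constCLM I _ (η o) + constCLM I _ (0, v₂)))
    refine ⟨η - constCLM I _ (η o) + constCLM I _ (v₁, v₂), ?_⟩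
    have h1 : constCLM I _ (v₁, v₂) = constCLM I (V₁ × V₂) (0, v₂) + constCLM I _ (v₁, 0) := by
      rw [← map_add]; simp
    have h2 : R (η - constCLM I _ (η o) + constCLM I _ (v₁, v₂)) = (η o).1 := by
      rw [h1, ← add_assoc, map_add R _ (constCLM I _ (v₁, 0)), hRL, hv₁]
      abel
    change M _ = η
    rw [hM, h2]
    ext t
    · simp
    · simp [hv₂]
  exact ⟨ContinuousLinearEquiv.ofBijective M hinj hsurj,
    ContinuousLinearEquiv.coe_ofBijective M hinj hsurj⟩

/-- **Bifurcation of solutions with prescribed boundary behaviour**: a nondegenerate zero of the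
averaged map continues to solutions of `Φ' = ε K(t, Φ)` on `[0, T]` whose first component is
`T`-periodic and whose second component satisfies `Φ₂(T) - Φ₂(0) = S Φ₂(0)`. -/
theorem exists_amplitudes {T : ℝ} (hT : 0 < T) (K : ℝ → V₁ × V₂ → V₁ × V₂)
    (K' : ℝ → V₁ × V₂ → V₁ × V₂ →L[ℝ] V₁ × V₂)
    (hK : Continuous (Function.uncurry K)) (hK' : Continuous (Function.uncurry K'))
    (hd : ∀ t x, HasFDerivAt (K t) (K' t x) x)
    (S : V₂ →L[ℝ] V₂) (hS : Function.Bijective S) (x₀ : V₁)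
    (h0 : ∫ s in (0 : ℝ)..T, (K s (x₀, 0)).1 = 0)
    (L : V₁ →L[ℝ] V₁) (hL : Function.Bijective L)
    (hdL : HasFDerivAt (fun x => ∫ s in (0 : ℝ)..T, (K s (x, 0)).1) L x₀) :
    ∃ ε₀ : ℝ, 0 < ε₀ ∧ ∃ Φ : ℝ → ℝ → V₁ × V₂,
      (∀ ε : ℝ, ε ≠ 0 → |ε| < ε₀ →
        (∀ t ∈ Set.Icc 0 T, HasDerivAt (Φ ε) (ε • K t (Φ ε t)) t) ∧
        (Φ ε T).1 = (Φ ε 0).1 ∧ (Φ ε T).2 - (Φ ε 0).2 = S (Φ ε 0).2) ∧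
      ∀ η > 0, ∀ᶠ ε in 𝓝[≠] (0 : ℝ), ∀ t ∈ Set.Icc 0 T, ‖Φ ε t - (x₀, 0)‖ < η := by
  let I := Set.Icc (0 : ℝ) T
  let o : I := ⟨0, le_rfl, hT.le⟩
  let e : I := ⟨T, hT.le, le_rfl⟩
  have hKI : Continuous (Function.uncurry fun t : I => K t) :=
    hK.comp (f := fun z : I × (V₁ × V₂) => (z.1.1, z.2)) (by fun_prop)
  have hKI' : Continuous (Function.uncurry fun t : I => K' t) :=
    hK'.comp (f := fun z : I × (V₁ × V₂) => (z.1.1, z.2)) (by fun_prop)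
  let c := constCLM I (V₁ × V₂)
  let N : C(I, V₁ × V₂) → C(I, V₁ × V₂) := superposition (fun t : I => K t) hKI
  let Φ₀ : C(I, V₁ × V₂) := c (x₀, 0)
  let N' : C(I, V₁ × V₂) →L[ℝ] C(I, V₁ × V₂) :=
    pointwiseApply (superposition (fun t : I => K' t) hKI' Φ₀)
  have hN : HasStrictFDerivAt N N' Φ₀ :=
    hasStrictFDerivAt_superposition _ _ hKI hKI' (fun t => hd t) Φ₀
  let J : C(I, V₁ × V₂) →L[ℝ] C(I, V₁ × V₂) := primitive T hT.le
  let ev : I → C(I, V₁ × V₂) →L[ℝ] V₁ × V₂ := fun t => ContinuousMap.evalCLM ℝ t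
  let P₁ := ContinuousLinearMap.fst ℝ V₁ V₂
  let P₂ := ContinuousLinearMap.snd ℝ V₁ V₂
  let R : C(I, V₁ × V₂) →L[ℝ] V₁ := P₁ ∘L ev e ∘L J
  let R₂ : C(I, V₁ × V₂) →L[ℝ] V₂ := P₂ ∘L ev e ∘L J
  have hJK : ∀ (x : V₁ × V₂), ev e (J (N (c x))) = ∫ s in (0 : ℝ)..T, K s x := by
    intro x
    refine intervalIntegral.integral_congr fun s hs => ?_
    rw [Set.uIcc_of_le hT.le] at hs
    change K (Set.projIcc 0 T hT.le s) x = K s x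
    rw [Set.projIcc_of_mem hT.le hs]
  have hRN : ∀ x : V₁, R (N (c (x, 0))) = ∫ s in (0 : ℝ)..T, (K s (x, 0)).1 := by
    intro x
    change P₁ (ev e (J (N (c (x, 0))))) = _
    rw [hJK]
    refine (P₁.intervalIntegral_comp_comm ?_).symm
    exact (hK.comp (f := fun s : ℝ => (s, (x, (0 : V₂)))) (by fun_prop)).intervalIntegrable _ _
  -- Restricted to constants, `R ∘ N` is the averaged map, so the chain rule and uniqueness of
  -- derivatives identify its derivative with `L`.
  have hRL : ∀ v : V₁, (R ∘L N') (c (v, 0)) = L v := by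
    have h1 : HasFDerivAt (fun x : V₁ => R (N ((c ∘L ContinuousLinearMap.inl ℝ V₁ V₂) x)))
        (R ∘L N' ∘L (c ∘L ContinuousLinearMap.inl ℝ V₁ V₂)) x₀ :=
      R.hasFDerivAt.comp x₀ (HasFDerivAt.comp (g := N) x₀ hN.hasFDerivAt
        (c ∘L ContinuousLinearMap.inl ℝ V₁ V₂).hasFDerivAt)
    have h2 := h1.unique (hdL.congr_of_eventuallyEq (Eventually.of_forall fun x => hRN x))
    exact fun v => congrArg (fun A : V₁ →L[ℝ] V₁ => A v) h2
  -- At `t = 0` only the last constant survives, so `H = 0` encodes the two boundary conditions and,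
  -- once they hold, the integral equation. The first condition appears already divided by `ε`;
  -- undivided it would be void at `ε = 0`.
  let H : ℝ × C(I, V₁ × V₂) → C(I, V₁ × V₂) := fun z =>
    z.2 - c (ev o z.2) - z.1 • J (N z.2) +
      c (R (N z.2), S (P₂ (ev o z.2)) - z.1 • R₂ (N z.2))
  let u : ℝ × C(I, V₁ × V₂) := (0, Φ₀)
  have h1 : HasStrictFDerivAt (fun z : ℝ × C(I, V₁ × V₂) => z.1)
    (ContinuousLinearMap.fst ℝ ℝ C(I, V₁ × V₂)) u := hasStrictFDerivAt_fst
  have h2 : HasStrictFDerivAt (fun z : ℝ × C(I, V₁ × V₂) => z.2)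
    (ContinuousLinearMap.snd ℝ ℝ C(I, V₁ × V₂)) u := hasStrictFDerivAt_snd
  have h3 : HasStrictFDerivAt (fun z : ℝ × C(I, V₁ × V₂) => N z.2)
    (N' ∘L ContinuousLinearMap.snd ℝ ℝ C(I, V₁ × V₂)) u :=
      HasStrictFDerivAt.comp (g := N) u hN h2
  -- Only the partial derivative in `Φ` at `ε = 0` matters; there the terms carrying the factor `ε`
  -- drop out.
  obtain ⟨H', hH, hH'⟩ : ∃ H', HasStrictFDerivAt H H' u ∧ ∀ δ,
      (H' ∘L ContinuousLinearMap.inr ℝ ℝ C(I, V₁ × V₂)) δ =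
        δ - c (δ o) + c ((R ∘L N') δ, S (δ o).2) := by
    refine ⟨_, ((h2.sub ((c ∘L ev o).hasStrictFDerivAt.comp u h2)).sub
      (h1.smul (J.hasStrictFDerivAt.comp u h3))).add
        (c.hasStrictFDerivAt.comp u ((R.hasStrictFDerivAt.comp u h3).prodMk
          (((S ∘L P₂ ∘L ev o).hasStrictFDerivAt.comp u h2).sub
            (h1.smul (R₂.hasStrictFDerivAt.comp u h3))))), fun δ => ?_⟩
    simp [u, ev, P₂]
  have hinv := isInvertible_linearization o _ (R ∘L N') S hS L hL hRL hH'
  have hJ0 : ∀ g, J g o = 0 := fun g => intervalIntegral.integral_same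
  have hHu : H u = 0 := by
    have e1 : R (N (c (x₀, 0))) = 0 := (hRN x₀).trans h0
    simp [H, u, Φ₀, e1, ev, P₂, c]
    rfl
  have hψ := hH.tendsto_implicitFunctionOfProdDomain hinv
  have hψ0 := hH.eventually_apply_implicitFunctionOfProdDomain hinv
  rw [hHu] at hψ0
  set ψ := hH.implicitFunctionOfProdDomain hinv
  obtain ⟨ε₀, hε₀, hball⟩ := Metric.eventually_nhds_iff_ball.1 hψ0
  -- Extending `ψ ε` by its end values keeps the integrand continuous on the line, so `Φ ε` has
  -- two-sided derivatives also at `0` and `T`.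
  let k : ℝ → ℝ → V₁ × V₂ := fun ε s => K s (ψ ε (Set.projIcc 0 T hT.le s))
  have hk : ∀ ε, Continuous (k ε) := fun ε => hK.comp
    (f := fun s : ℝ => (s, ψ ε (Set.projIcc 0 T hT.le s)))
    (continuous_id.prodMk ((ψ ε).continuous.comp continuous_projIcc))
  have hJk : ∀ ε (t : I), J (N (ψ ε)) t = ∫ s in (0 : ℝ)..t, k ε s := by
    intro ε t
    refine intervalIntegral.integral_congr fun s hs => ?_
    rw [Set.uIcc_of_le t.2.1] at hs
    change K (Set.projIcc 0 T hT.le s) _ = K s _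
    rw [Set.projIcc_of_mem hT.le ⟨hs.1, hs.2.trans t.2.2⟩]
  let Φ : ℝ → ℝ → V₁ × V₂ := fun ε t => ψ ε o + ε • ∫ s in (0 : ℝ)..t, k ε s
  have key : ∀ ε, |ε| < ε₀ → (∀ t : I, Φ ε t = ψ ε t) ∧ R (N (ψ ε)) = 0 ∧
      S (ψ ε o).2 = ε • R₂ (N (ψ ε)) := by
    intro ε hε
    have h4 : H (ε, ψ ε) = 0 := hball ε (by simpa [u] using hε)
    have h5 : (R (N (ψ ε)), S (ψ ε o).2 - ε • R₂ (N (ψ ε))) = 0 := by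
      have := congrArg (fun g : C(I, V₁ × V₂) => g o) h4
      simpa [H, hJ0, ev, c, P₂] using this
    refine ⟨fun t => ?_, congrArg Prod.fst h5, sub_eq_zero.1 (congrArg Prod.snd h5)⟩
    have h6 : H (ε, ψ ε) = ψ ε - c (ψ ε o) - ε • J (N (ψ ε)) +
      c (R (N (ψ ε)), S (ψ ε o).2 - ε • R₂ (N (ψ ε))) := rfl
    rw [h5, h4, map_zero, add_zero] at h6
    have h7 : (0 : V₁ × V₂) = ψ ε t - ψ ε o - ε • J (N (ψ ε)) t :=
      congrArg (fun g : C(I, V₁ × V₂) => g t) h6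
    rw [hJk, sub_sub, eq_comm, sub_eq_zero] at h7
    exact h7.symm
  refine ⟨ε₀, hε₀, Φ, fun ε _ hε => ?_, fun η hη => ?_⟩
  · obtain ⟨k1, k2, k3⟩ := key ε hε
    have hT1 : Φ ε T = ψ ε o + ε • J (N (ψ ε)) e := by rw [hJk]
    have hz : Φ ε 0 = ψ ε o := k1 o
    refine ⟨fun t ht => ?_, ?_, ?_⟩
    · have h8 := (((hk ε).integral_hasStrictDerivAt 0 t).hasDerivAt.const_smul ε).const_add
        (ψ ε o)
      have h9 : k ε t = K t (Φ ε t) := by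
        change K t (ψ ε (Set.projIcc 0 T hT.le t)) = _
        rw [Set.projIcc_of_mem hT.le ht, ← k1 ⟨t, ht⟩]
      rwa [h9] at h8
    · rw [hT1, hz]
      have : (J (N (ψ ε)) e).1 = 0 := k2
      simp [this]
    · rw [hT1, hz, k3]
      simp [R₂, P₂, ev]
  · have h10 : ∀ᶠ ε in 𝓝 (0 : ℝ), ψ ε ∈ Metric.ball Φ₀ η := hψ (Metric.ball_mem_nhds _ hη)
    have h11 : ∀ᶠ ε in 𝓝 (0 : ℝ), ε ∈ Metric.ball (0 : ℝ) ε₀ := Metric.ball_mem_nhds _ hε₀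
    filter_upwards [h10.filter_mono nhdsWithin_le_nhds, h11.filter_mono nhdsWithin_le_nhds]
      with ε hε1 hε2 t ht
    rw [(key ε (by simpa using hε2)).1 ⟨t, ht⟩, ← dist_eq_norm]
    exact (ContinuousMap.dist_apply_le_dist (f := ψ ε) (g := Φ₀) _).trans_lt hε1

end Averaging

end DoublePendulum

/-! ### Normal modes and variation of constants. -/

namespace DoublePendulum

/-- The frequency `√(2 + √2)` of the fast mode. -/
noncomputable def fastFreq : ℝ := √(2 + √2)

lemma sq_sqrt_two : √2 ^ 2 = (2 : ℝ) := Real.sq_sqrt (by norm_num)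

lemma one_lt_sqrt_two : 1 < √(2 : ℝ) := by
  nlinarith [sq_sqrt_two, Real.sqrt_nonneg 2]

lemma sqrt_two_lt : √(2 : ℝ) < 3 / 2 := by
  nlinarith [sq_sqrt_two, Real.sqrt_nonneg 2]

lemma freq_sq : freq ^ 2 = 2 - √2 := Real.sq_sqrt (by linarith [sqrt_two_lt])

lemma fastFreq_sq : fastFreq ^ 2 = 2 + √2 := Real.sq_sqrt (by positivity)

/-- A crude bound: dividing by the frequency then costs at most a factor `2`. -/
lemma half_le_freq : 1 / 2 ≤ freq :=
  Real.le_sqrt_of_sq_le (by linarith [sqrt_two_lt])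

lemma half_le_fastFreq : 1 / 2 ≤ fastFreq :=
  Real.le_sqrt_of_sq_le (by linarith [one_lt_sqrt_two])

lemma freq_pos : 0 < freq := by linarith [half_le_freq]

lemma fastFreq_pos : 0 < fastFreq := by linarith [half_le_fastFreq]

/-- Rests on `2 + √2 = (1 + √2)² (2 - √2)`; the irrational ratio is the source of nonresonance. -/
lemma fastFreq_eq : fastFreq = (1 + √2) * freq := by
  have h : fastFreq ^ 2 = ((1 + √2) * freq) ^ 2 := by
    rw [mul_pow, freq_sq, fastFreq_sq]
    linear_combination (√2) * sq_sqrt_two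
  exact (pow_left_inj₀ fastFreq_pos.le (by have := freq_pos; positivity) two_ne_zero).1 h

lemma sqrt_four_sub : √(4 - 2 * √2) = √2 * freq := by
  rw [freq, ← Real.sqrt_mul (by norm_num)]
  ring_nf

lemma slowPeriod_pos : 0 < slowPeriod :=
  div_pos Real.two_pi_pos freq_pos

lemma freq_mul_slowPeriod : freq * slowPeriod = 2 * Real.pi :=
  mul_div_cancel₀ _ freq_pos.ne'

/-- Position of the harmonic oscillator of frequency `w` with amplitudes `X`, `Y`. -/
noncomputable def pos (w X Y t : ℝ) : ℝ := (X * Real.cos (w * t) + Y * Real.sin (w * t)) / w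

/-- Velocity of the harmonic oscillator of frequency `w` with amplitudes `X`, `Y`. -/
noncomputable def vel (w X Y t : ℝ) : ℝ := Y * Real.cos (w * t) - X * Real.sin (w * t)

lemma A_eq (X Y t : ℝ) : A X Y t = pos freq X Y t / √2 := by
  rw [A, pos, sqrt_four_sub]
  field_simp

lemma B_eq (X Y t : ℝ) : B X Y t = vel freq X Y t / √2 := by
  rw [B, vel]
  ring

lemma C_eq (X Y t : ℝ) : C X Y t = pos freq X Y t := by
  rw [C, pos, freq]
  ring

lemma D_eq (X Y t : ℝ) : D X Y t = vel freq X Y t := rfl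

/-- Variation of constants for the position of a forced harmonic oscillator. -/
lemma hasDerivAt_pos {w : ℝ} (hw : w ≠ 0) {X Y : ℝ → ℝ} {a t : ℝ}
    (hX : HasDerivAt X (-(a * Real.sin (w * t))) t) (hY : HasDerivAt Y (a * Real.cos (w * t)) t) :
    HasDerivAt (fun t => pos w (X t) (Y t) t) (vel w (X t) (Y t) t) t := by
  have hl : HasDerivAt (fun t : ℝ => w * t) w t := by simpa using (hasDerivAt_id t).const_mul w
  have := ((hX.mul hl.cos).add (hY.mul hl.sin)).div_const w
  refine this.congr_deriv ?_
  rw [vel]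
  field_simp
  ring

/-- Variation of constants for the velocity of a forced harmonic oscillator. -/
lemma hasDerivAt_vel (w : ℝ) {X Y : ℝ → ℝ} {a t : ℝ}
    (hX : HasDerivAt X (-(a * Real.sin (w * t))) t) (hY : HasDerivAt Y (a * Real.cos (w * t)) t) :
    HasDerivAt (fun t => vel w (X t) (Y t) t) (-w ^ 2 * pos w (X t) (Y t) t + a) t := by
  have hl : HasDerivAt (fun t : ℝ => w * t) w t := by simpa using (hasDerivAt_id t).const_mul w
  have := (hY.mul hl.cos).sub (hX.mul hl.sin)
  refine this.congr_deriv ?_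
  have h : w * ((X t * Real.cos (w * t) + Y t * Real.sin (w * t)) / w) * w =
      w * (X t * Real.cos (w * t) + Y t * Real.sin (w * t)) := by
    rcases eq_or_ne w 0 with rfl | hw
    · simp
    · field_simp
  rw [pos]
  linear_combination h + a * Real.sin_sq_add_cos_sq (w * t)

lemma abs_cos_add_sin_le {X Y r : ℝ} (hX : |X| ≤ r) (hY : |Y| ≤ r) (t : ℝ) :
    |X * Real.cos t + Y * Real.sin t| ≤ 2 * r := by
  have h1 : |X * Real.cos t| ≤ r := by
    rw [abs_mul]
    exact (mul_le_of_le_one_right (abs_nonneg _) (Real.abs_cos_le_one t)).trans hX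
  have h2 : |Y * Real.sin t| ≤ r := by
    rw [abs_mul]
    exact (mul_le_of_le_one_right (abs_nonneg _) (Real.abs_sin_le_one t)).trans hY
  linarith [abs_add_le (X * Real.cos t) (Y * Real.sin t)]

lemma abs_pos_le {w : ℝ} (hw : 1 / 2 ≤ w) {X Y r : ℝ} (hX : |X| ≤ r) (hY : |Y| ≤ r) (t : ℝ) :
    |pos w X Y t| ≤ 4 * r := by
  have hr : 0 ≤ r := (abs_nonneg X).trans hX
  have hw0 : 0 < w := by linarith
  rw [pos, abs_div, abs_of_pos hw0, div_le_iff₀ hw0]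
  nlinarith [abs_cos_add_sin_le hX hY (w * t)]

lemma abs_vel_le (w : ℝ) {X Y r : ℝ} (hX : |X| ≤ r) (hY : |Y| ≤ r) (t : ℝ) :
    |vel w X Y t| ≤ 4 * r := by
  have hr : 0 ≤ r := (abs_nonneg X).trans hX
  have := abs_cos_add_sin_le hY (X := Y) (Y := -X) (by simpa using hX) (w * t)
  rw [vel, sub_eq_add_neg, ← neg_mul]
  linarith

lemma hasDerivAt_comp_fst {E F : Type*} [NormedAddCommGroup E] [NormedSpace ℝ E]
    [NormedAddCommGroup F] [NormedSpace ℝ F] {f : ℝ → E × F} {f' : E × F} {t : ℝ}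
    (h : HasDerivAt f f' t) : HasDerivAt (fun t => (f t).1) f'.1 t :=
  (ContinuousLinearMap.fst ℝ E F).hasFDerivAt.comp_hasDerivAt t h

lemma hasDerivAt_comp_snd {E F : Type*} [NormedAddCommGroup E] [NormedSpace ℝ E]
    [NormedAddCommGroup F] [NormedSpace ℝ F] {f : ℝ → E × F} {f' : E × F} {t : ℝ}
    (h : HasDerivAt f f' t) : HasDerivAt (fun t => (f t).2) f'.2 t :=
  (ContinuousLinearMap.snd ℝ E F).hasFDerivAt.comp_hasDerivAt t h

/-! ### Amplitude coordinates on the phase space. -/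

/-- The point `(θ₁, θ₁', θ₂, θ₂')` of the phase space with given amplitudes of the slow and of the
fast mode at time `t`. -/
noncomputable def phase (t : ℝ) (v : (ℝ × ℝ) × (ℝ × ℝ)) : ℝ × ℝ × ℝ × ℝ :=
  ((pos freq v.1.1 v.1.2 t - pos fastFreq v.2.1 v.2.2 t) / √2,
    (vel freq v.1.1 v.1.2 t - vel fastFreq v.2.1 v.2.2 t) / √2,
    pos freq v.1.1 v.1.2 t + pos fastFreq v.2.1 v.2.2 t,
    vel freq v.1.1 v.1.2 t + vel fastFreq v.2.1 v.2.2 t)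

lemma phase_slow (X Y t : ℝ) :
    phase t ((X, Y), 0) = (A X Y t, B X Y t, C X Y t, D X Y t) := by
  rw [A_eq, B_eq, C_eq, D_eq]
  simp [phase, pos, vel]

lemma phase_sub (t : ℝ) (v w : (ℝ × ℝ) × (ℝ × ℝ)) : phase t v - phase t w = phase t (v - w) := by
  ext <;> simp [phase, pos, vel] <;> ring

/-- Two modes, each bounded by `4 * ‖v‖`. The bound is uniform in `t`, so closeness of amplitudes
passes to the phase space. -/
lemma norm_phase_le (t : ℝ) (v : (ℝ × ℝ) × (ℝ × ℝ)) : ‖phase t v‖ ≤ 8 * ‖v‖ := by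
  have h11 : |v.1.1| ≤ ‖v‖ := (norm_fst_le v.1).trans (norm_fst_le v)
  have h12 : |v.1.2| ≤ ‖v‖ := (norm_snd_le v.1).trans (norm_fst_le v)
  have h21 : |v.2.1| ≤ ‖v‖ := (norm_fst_le v.2).trans (norm_snd_le v)
  have h22 : |v.2.2| ≤ ‖v‖ := (norm_snd_le v.2).trans (norm_snd_le v)
  have p1 := abs_pos_le half_le_freq h11 h12 t
  have p2 := abs_pos_le half_le_fastFreq h21 h22 t
  have v1 := abs_vel_le freq h11 h12 t
  have v2 := abs_vel_le fastFreq h21 h22 t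
  have hdiv : ∀ z : ℝ, |z| ≤ 8 * ‖v‖ → |z / √2| ≤ 8 * ‖v‖ := fun z hz => by
    rw [abs_div, abs_of_nonneg (Real.sqrt_nonneg 2)]
    exact (div_le_self (abs_nonneg _) one_lt_sqrt_two.le).trans hz
  rw [phase, Prod.norm_mk, Prod.norm_mk, Prod.norm_mk]
  simp only [Real.norm_eq_abs]
  refine max_le (hdiv _ ?_) (max_le (hdiv _ ?_) (max_le ?_ ?_))
  · exact (abs_sub _ _).trans (by linarith)
  · exact (abs_sub _ _).trans (by linarith)
  · exact (abs_add_le _ _).trans (by linarith)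
  · exact (abs_add_le _ _).trans (by linarith)

lemma contDiff_phase {n : WithTop ℕ∞} : ContDiff ℝ n (Function.uncurry phase) := by
  unfold phase pos vel
  simp only [Function.uncurry_def]
  fun_prop

/-- The right-hand side of the equations for the amplitudes. -/
noncomputable def ampField (F₁ F₂ : ℝ × ℝ × ℝ × ℝ × ℝ → ℝ) (t : ℝ) (v : (ℝ × ℝ) × (ℝ × ℝ)) :
    (ℝ × ℝ) × (ℝ × ℝ) :=
  ((-((√2 * F₁ (t, phase t v) + F₂ (t, phase t v)) / 2 * Real.sin (freq * t)),
      (√2 * F₁ (t, phase t v) + F₂ (t, phase t v)) / 2 * Real.cos (freq * t)),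
    (-((F₂ (t, phase t v) - √2 * F₁ (t, phase t v)) / 2 * Real.sin (fastFreq * t)),
      (F₂ (t, phase t v) - √2 * F₁ (t, phase t v)) / 2 * Real.cos (fastFreq * t)))

lemma contDiff_ampField {F₁ F₂ : ℝ × ℝ × ℝ × ℝ × ℝ → ℝ} {n : WithTop ℕ∞} (hF₁ : ContDiff ℝ n F₁)
    (hF₂ : ContDiff ℝ n F₂) : ContDiff ℝ n (Function.uncurry (ampField F₁ F₂)) := by
  have h1 : ContDiff ℝ n fun z : ℝ × ((ℝ × ℝ) × (ℝ × ℝ)) => F₁ (z.1, phase z.1 z.2) :=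
    hF₁.comp (contDiff_fst.prodMk contDiff_phase)
  have h2 : ContDiff ℝ n fun z : ℝ × ((ℝ × ℝ) × (ℝ × ℝ)) => F₂ (z.1, phase z.1 z.2) :=
    hF₂.comp (contDiff_fst.prodMk contDiff_phase)
  unfold ampField
  simp only [Function.uncurry_def]
  have h3 : ContDiff ℝ n fun z : ℝ × ((ℝ × ℝ) × (ℝ × ℝ)) => Real.sin (freq * z.1) := by fun_prop
  have h4 : ContDiff ℝ n fun z : ℝ × ((ℝ × ℝ) × (ℝ × ℝ)) => Real.cos (freq * z.1) := by fun_prop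
  have h5 : ContDiff ℝ n fun z : ℝ × ((ℝ × ℝ) × (ℝ × ℝ)) => Real.sin (fastFreq * z.1) := by
    fun_prop
  have h6 : ContDiff ℝ n fun z : ℝ × ((ℝ × ℝ) × (ℝ × ℝ)) => Real.cos (fastFreq * z.1) := by
    fun_prop
  have h7 := ((contDiff_const (c := √2)).mul h1).add h2 |>.div_const 2
  have h8 := h2.sub ((contDiff_const (c := √2)).mul h1) |>.div_const 2
  exact ((h7.mul h3).neg.prodMk (h7.mul h4)).prodMk ((h8.mul h5).neg.prodMk (h8.mul h6))

/-- The vector field of the perturbed double pendulum in the phase space. -/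
noncomputable def pendulumField (F₁ F₂ : ℝ × ℝ × ℝ × ℝ × ℝ → ℝ) (ε t : ℝ) (u : ℝ × ℝ × ℝ × ℝ) :
    ℝ × ℝ × ℝ × ℝ :=
  (u.2.1, -2 * u.1 + u.2.2.1 + ε * F₁ (t, u), u.2.2.2, 2 * u.1 - 2 * u.2.2.1 + ε * F₂ (t, u))

lemma continuous_pendulumField {F₁ F₂ : ℝ × ℝ × ℝ × ℝ × ℝ → ℝ} (hF₁ : Continuous F₁)
    (hF₂ : Continuous F₂) (ε : ℝ) : Continuous (Function.uncurry (pendulumField F₁ F₂ ε)) := by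
  unfold pendulumField
  simp only [Function.uncurry_def]
  fun_prop

/-- The phase space trajectory of a solution of the amplitude equations solves the equations of
the perturbed double pendulum. -/
lemma hasDerivAt_phase {F₁ F₂ : ℝ × ℝ × ℝ × ℝ × ℝ → ℝ} {ε t : ℝ} {Φ : ℝ → (ℝ × ℝ) × (ℝ × ℝ)}
    (h : HasDerivAt Φ (ε • ampField F₁ F₂ t (Φ t)) t) :
    HasDerivAt (fun t => phase t (Φ t)) (pendulumField F₁ F₂ ε t (phase t (Φ t))) t := by
  have a1 := hasDerivAt_comp_fst (hasDerivAt_comp_fst h)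
  have a2 := hasDerivAt_comp_snd (hasDerivAt_comp_fst h)
  have b1 := hasDerivAt_comp_fst (hasDerivAt_comp_snd h)
  have b2 := hasDerivAt_comp_snd (hasDerivAt_comp_snd h)
  set u := phase t (Φ t) with hu
  -- The mode coordinates are `(θ₂ ± √2 θ₁) / 2`, hence the forcings `(F₂ ± √2 F₁) / 2`.
  have hs₁ : HasDerivAt (fun t => (Φ t).1.1)
      (-((ε * (√2 * F₁ (t, u) + F₂ (t, u)) / 2) * Real.sin (freq * t))) t :=
    a1.congr_deriv (by simp [ampField, ← hu]; ring)
  have hs₂ : HasDerivAt (fun t => (Φ t).1.2)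
      ((ε * (√2 * F₁ (t, u) + F₂ (t, u)) / 2) * Real.cos (freq * t)) t :=
    a2.congr_deriv (by simp [ampField, ← hu]; ring)
  have hf₁ : HasDerivAt (fun t => (Φ t).2.1)
      (-((ε * (F₂ (t, u) - √2 * F₁ (t, u)) / 2) * Real.sin (fastFreq * t))) t :=
    b1.congr_deriv (by simp [ampField, ← hu]; ring)
  have hf₂ : HasDerivAt (fun t => (Φ t).2.2)
      ((ε * (F₂ (t, u) - √2 * F₁ (t, u)) / 2) * Real.cos (fastFreq * t)) t :=
    b2.congr_deriv (by simp [ampField, ← hu]; ring)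
  have ps := hasDerivAt_pos freq_pos.ne' hs₁ hs₂
  have vs := hasDerivAt_vel freq hs₁ hs₂
  have pf := hasDerivAt_pos fastFreq_pos.ne' hf₁ hf₂
  have vf := hasDerivAt_vel fastFreq hf₁ hf₂
  refine HasDerivAt.prodMk ((ps.sub pf).div_const _) (HasDerivAt.prodMk
    (((vs.sub vf).div_const _).congr_deriv ?_) (HasDerivAt.prodMk (ps.add pf)
      ((vs.add vf).congr_deriv ?_)))
  · have h1 : u.1 = (pos freq (Φ t).1.1 (Φ t).1.2 t - pos fastFreq (Φ t).2.1 (Φ t).2.2 t) / √2 :=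
      rfl
    have h2 : u.2.2.1 = pos freq (Φ t).1.1 (Φ t).1.2 t + pos fastFreq (Φ t).2.1 (Φ t).2.2 t := rfl
    rw [h1, h2, freq_sq, fastFreq_sq]
    generalize pos freq (Φ t).1.1 (Φ t).1.2 t = x
    generalize pos fastFreq (Φ t).2.1 (Φ t).2.2 t = y
    have h3 : √(2 : ℝ) ≠ 0 := by positivity
    field_simp
    ring
  · have h1 : u.1 = (pos freq (Φ t).1.1 (Φ t).1.2 t - pos fastFreq (Φ t).2.1 (Φ t).2.2 t) / √2 :=
      rfl
    have h2 : u.2.2.1 = pos freq (Φ t).1.1 (Φ t).1.2 t + pos fastFreq (Φ t).2.1 (Φ t).2.2 t := rfl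
    rw [h1, h2, freq_sq, fastFreq_sq]
    generalize pos freq (Φ t).1.1 (Φ t).1.2 t = x
    generalize pos fastFreq (Φ t).2.1 (Φ t).2.2 t = y
    have h3 : √(2 : ℝ) ≠ 0 := by positivity
    field_simp
    linear_combination 2 * (x - y) * sq_sqrt_two

lemma isSolution_of_hasDerivAt {F₁ F₂ : ℝ × ℝ × ℝ × ℝ × ℝ → ℝ} {ε : ℝ} {y : ℝ → ℝ × ℝ × ℝ × ℝ}
    (hy : ∀ t, HasDerivAt y (pendulumField F₁ F₂ ε t (y t)) t) :
    IsSolution F₁ F₂ ε (fun t => (y t).1) (fun t => (y t).2.2.1) ∧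
      deriv (fun t => (y t).1) = (fun t => (y t).2.1) ∧
      deriv (fun t => (y t).2.2.1) = (fun t => (y t).2.2.2) := by
  have h1 : ∀ t, HasDerivAt (fun t => (y t).1) (y t).2.1 t := fun t => hasDerivAt_comp_fst (hy t)
  have h2 : ∀ t, HasDerivAt (fun t => (y t).2.2.1) (y t).2.2.2 t := fun t => hasDerivAt_comp_fst (hasDerivAt_comp_snd (hasDerivAt_comp_snd (hy t)))
  have d1 : deriv (fun t => (y t).1) = (fun t => (y t).2.1) := funext fun t => (h1 t).deriv
  have d2 : deriv (fun t => (y t).2.2.1) = (fun t => (y t).2.2.2) := funext fun t => (h2 t).deriv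
  refine ⟨⟨fun t => (h1 t).differentiableAt, fun t => (h2 t).differentiableAt, ?_, ?_⟩, d1, d2⟩
  · intro t
    rw [d1, d2]
    exact hasDerivAt_comp_fst (hasDerivAt_comp_snd (hy t))
  · intro t
    rw [d1, d2]
    exact hasDerivAt_comp_snd (hasDerivAt_comp_snd (hasDerivAt_comp_snd (hy t)))

end DoublePendulum

/-! ### Minimal period, nonresonance and the averaged functions. -/

namespace DoublePendulum

lemma isSolution_slow (F₁ F₂ : ℝ × ℝ × ℝ × ℝ × ℝ → ℝ) (X Y : ℝ) :
    IsSolution F₁ F₂ 0 (A X Y) (C X Y) := by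
  have hd : ∀ t, HasDerivAt (fun t => phase t ((X, Y), 0))
      (pendulumField F₁ F₂ 0 t (phase t ((X, Y), 0))) t := fun t =>
    hasDerivAt_phase (Φ := fun _ => ((X, Y), 0)) ((hasDerivAt_const t _).congr_deriv (by simp))
  simpa only [phase_slow] using (isSolution_of_hasDerivAt hd).1

lemma slow_periodic {S : ℝ} {n : ℤ} (hS : freq * S = n * (2 * Real.pi)) (X Y t : ℝ) :
    (A X Y (t + S), B X Y (t + S), C X Y (t + S), D X Y (t + S)) =
      (A X Y t, B X Y t, C X Y t, D X Y t) := by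
  simp only [A, B, C, D, mul_add, hS, Real.cos_add_int_mul_two_pi, Real.sin_add_int_mul_two_pi]

/-- Periodicity of `C`, tested at time `0` and a quarter period later, gives two relations that
combine to `(X² + Y²) (cos (freq * S) - 1) = 0`. -/
lemma isLeast_slowPeriod {X Y : ℝ} (hXY : (X, Y) ≠ (0, 0)) :
    IsLeast {S : ℝ | 0 < S ∧ Function.Periodic (A X Y) S ∧ Function.Periodic (C X Y) S}
      slowPeriod := by
  have hT : freq * slowPeriod = (1 : ℤ) * (2 * Real.pi) := by
    simpa using freq_mul_slowPeriod
  refine ⟨⟨slowPeriod_pos, fun t => congrArg Prod.fst (slow_periodic hT X Y t),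
    fun t => congrArg (fun u => u.2.2.1) (slow_periodic hT X Y t)⟩, ?_⟩
  rintro S ⟨hS, -, hC⟩
  have hw := freq_pos
  have h0 := hC 0
  have h1 := hC (Real.pi / 2 / freq)
  rw [C_eq, C_eq, pos, pos, div_left_inj' hw.ne'] at h0 h1
  have e1 : freq * (Real.pi / 2 / freq) = Real.pi / 2 := mul_div_cancel₀ _ hw.ne'
  simp only [zero_add, mul_zero, Real.cos_zero, Real.sin_zero, mul_add, e1, Real.cos_add,
    Real.sin_add, Real.cos_pi_div_two, Real.sin_pi_div_two] at h0 h1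
  have hne : X ^ 2 + Y ^ 2 ≠ 0 := fun h => hXY (by
    have hX : X = 0 := by nlinarith
    have hY : Y = 0 := by nlinarith
    rw [hX, hY])
  have hcos : Real.cos (freq * S) = 1 := by
    apply mul_left_cancel₀ hne
    linear_combination X * h0 + Y * h1
  obtain ⟨n, hn⟩ := (Real.cos_eq_one_iff _).1 hcos
  have hn1 : 1 ≤ n := by
    have h2 : 0 < (n : ℝ) * (2 * Real.pi) := hn ▸ mul_pos hw hS
    have h3 : 0 < (n : ℝ) := pos_of_mul_pos_left h2 Real.two_pi_pos.le
    exact_mod_cast h3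
  have hn2 : (1 : ℝ) ≤ n := by exact_mod_cast hn1
  refine le_of_mul_le_mul_left ?_ hw
  rw [freq_mul_slowPeriod, ← hn]
  nlinarith [Real.two_pi_pos]

/-- During `p` slow periods the fast mode makes `(1 + √2) p` turns, an irrational number. -/
lemma cos_fastFreq_ne_one {p : ℕ} (hp : 0 < p) : Real.cos (fastFreq * (p * slowPeriod)) ≠ 1 := by
  intro h
  obtain ⟨n, hn⟩ := (Real.cos_eq_one_iff _).1 h
  have h1 : fastFreq * (p * slowPeriod) = ((1 + √2) * p) * (2 * Real.pi) := by
    rw [fastFreq_eq, ← freq_mul_slowPeriod]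
    ring
  rw [h1, mul_left_inj' Real.two_pi_pos.ne'] at hn
  have hirr : Irrational ((1 + √2) * p) := by
    have := (irrational_sqrt_two.natCast_add 1).mul_natCast hp.ne'
    simpa using this
  exact hirr.ne_int n hn.symm

/-- `w ↦ R w - w` for the rotation `R` of the plane by the angle with cosine `c` and sine `s`. -/
def rotationSubId (c s : ℝ) : ℝ × ℝ →L[ℝ] ℝ × ℝ :=
  ((c - 1) • ContinuousLinearMap.fst ℝ ℝ ℝ - s • ContinuousLinearMap.snd ℝ ℝ ℝ).prod
    (s • ContinuousLinearMap.fst ℝ ℝ ℝ + (c - 1) • ContinuousLinearMap.snd ℝ ℝ ℝ)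

lemma rotationSubId_apply (c s : ℝ) (w : ℝ × ℝ) :
    rotationSubId c s w = ((c - 1) * w.1 - s * w.2, s * w.1 + (c - 1) * w.2) := rfl

/-- The determinant is `(c - 1)² + s²`. -/
lemma rotationSubId_bijective {c : ℝ} (s : ℝ) (hc : c ≠ 1) :
    Function.Bijective (rotationSubId c s) := by
  have hd : (c - 1) ^ 2 + s ^ 2 ≠ 0 := fun h => sub_ne_zero.2 hc (by nlinarith)
  have hinj : Function.Injective (rotationSubId c s).toLinearMap := by
    rw [← LinearMap.ker_eq_bot]
    refine LinearMap.ker_eq_bot'.2 fun w hw => ?_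
    have hw' : rotationSubId c s w = 0 := hw
    rw [rotationSubId_apply] at hw'
    have h1 := congrArg Prod.fst hw'
    have h2 := congrArg Prod.snd hw'
    simp only [Prod.fst_zero, Prod.snd_zero] at h1 h2
    ext
    · apply mul_left_cancel₀ hd
      simp only [Prod.fst_zero]
      linear_combination (c - 1) * h1 + s * h2
    · apply mul_left_cancel₀ hd
      simp only [Prod.snd_zero]
      linear_combination (c - 1) * h2 - s * h1
  exact ⟨hinj, LinearMap.injective_iff_surjective.1 hinj⟩

/-- Differentiability comes for free: where it fails, `fderiv` is `0`, whose determinant vanishes on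
a nontrivial space. -/
lemma hasFDerivAt_of_det_ne_zero {E : Type*} [NormedAddCommGroup E] [NormedSpace ℝ E]
    [FiniteDimensional ℝ E] [Nontrivial E] {g : E → E} {x : E} (h : (fderiv ℝ g x).det ≠ 0) :
    HasFDerivAt g (fderiv ℝ g x) x ∧ Function.Bijective (fderiv ℝ g x) := by
  refine ⟨DifferentiableAt.hasFDerivAt ?_,
    (Module.End.isUnit_iff _).1 ((LinearMap.isUnit_iff_isUnit_det _).2 (isUnit_iff_ne_zero.2 h))⟩
  by_contra hg
  rw [fderiv_zero_of_not_differentiableAt hg] at h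
  exact h (LinearMap.det_zero.trans (zero_pow Module.finrank_pos.ne'))

lemma integral_ampField_fst {F₁ F₂ : ℝ × ℝ × ℝ × ℝ × ℝ → ℝ} (hF₁ : Continuous F₁)
    (hF₂ : Continuous F₂) (p : ℕ) (x : ℝ × ℝ) :
    ∫ s in (0 : ℝ)..(p * slowPeriod), (ampField F₁ F₂ s (x, 0)).1 =
      (-1 / 2 * G₁ F₁ F₂ p x.1 x.2, 1 / 2 * G₂ F₁ F₂ p x.1 x.2) := by
  have hc : Continuous fun s => (ampField F₁ F₂ s (x, 0)).1 := by
    have h := (contDiff_ampField (n := 0) (contDiff_zero.2 hF₁) (contDiff_zero.2 hF₂)).continuous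
    exact continuous_fst.comp (h.comp (f := fun s : ℝ => (s, (x, (0 : ℝ × ℝ)))) (by fun_prop))
  have hi := hc.intervalIntegrable (μ := MeasureTheory.volume) 0 (p * slowPeriod)
  ext
  · refine ((ContinuousLinearMap.fst ℝ ℝ ℝ).intervalIntegral_comp_comm hi).symm.trans ?_
    simp only [G₁]
    rw [← intervalIntegral.integral_const_mul]
    refine intervalIntegral.integral_congr fun s _ => ?_
    have e := phase_slow x.1 x.2 s
    rw [Prod.mk.eta] at e
    simp only [ContinuousLinearMap.coe_fst', ampField, along, e]
    ring
  · refine ((ContinuousLinearMap.snd ℝ ℝ ℝ).intervalIntegral_comp_comm hi).symm.trans ?_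
    simp only [G₂]
    rw [← intervalIntegral.integral_const_mul]
    refine intervalIntegral.integral_congr fun s _ => ?_
    have e := phase_slow x.1 x.2 s
    rw [Prod.mk.eta] at e
    simp only [ContinuousLinearMap.coe_snd', ampField, along, e]
    ring

/-- The trajectory returns to its initial point at time `p T₁` if the slow amplitudes are
periodic and the fast ones undergo the rotation compensating the phase shift of the fast mode. -/
lemma phase_zero_eq_phase_period {p : ℕ} {v w : (ℝ × ℝ) × (ℝ × ℝ)} (h1 : w.1 = v.1)
    (h2 : w.2 - v.2 = rotationSubId (Real.cos (fastFreq * (p * slowPeriod)))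
      (Real.sin (fastFreq * (p * slowPeriod))) v.2) :
    phase 0 v = phase (p * slowPeriod) w := by
  have hT : freq * (p * slowPeriod) = (p : ℤ) * (2 * Real.pi) := by
    rw [← freq_mul_slowPeriod]
    push_cast
    ring
  have hc : Real.cos (freq * (p * slowPeriod)) = 1 := by
    rw [hT, Real.cos_int_mul_two_pi]
  have hs : Real.sin (freq * (p * slowPeriod)) = 0 := by
    rw [hT]
    simpa using Real.sin_add_int_mul_two_pi 0 p
  have hcs := Real.sin_sq_add_cos_sq (fastFreq * (p * slowPeriod))
  rw [rotationSubId_apply] at h2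
  have e1 := congrArg Prod.fst h2
  have e2 := congrArg Prod.snd h2
  simp only [Prod.fst_sub, Prod.snd_sub] at e1 e2
  have p1 : pos freq w.1.1 w.1.2 (p * slowPeriod) = pos freq v.1.1 v.1.2 0 := by
    simp [pos, h1, hc, hs]
  have v1 : vel freq w.1.1 w.1.2 (p * slowPeriod) = vel freq v.1.1 v.1.2 0 := by
    simp [vel, h1, hc, hs]
  -- By `h2`, `w.2` is `v.2` rotated; evaluating the mode at the final time applies the inverse
  -- rotation.
  have p2 : pos fastFreq w.2.1 w.2.2 (p * slowPeriod) = pos fastFreq v.2.1 v.2.2 0 := by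
    simp only [pos, mul_zero, Real.cos_zero, Real.sin_zero]
    generalize Real.cos (fastFreq * (p * slowPeriod)) = c at *
    generalize Real.sin (fastFreq * (p * slowPeriod)) = s at *
    congr 1
    linear_combination c * e1 + s * e2 + v.2.1 * hcs
  have v2 : vel fastFreq w.2.1 w.2.2 (p * slowPeriod) = vel fastFreq v.2.1 v.2.2 0 := by
    simp only [vel, mul_zero, Real.cos_zero, Real.sin_zero]
    generalize Real.cos (fastFreq * (p * slowPeriod)) = c at *
    generalize Real.sin (fastFreq * (p * slowPeriod)) = s at *
    linear_combination c * e2 - s * e1 + v.2.2 * hcs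
  simp only [phase, p1, v1, p2, v2]

/-! ### Assembling the periodic solutions. -/

/-- Existence and convergence of the periodic solutions, in the phase space. -/
theorem exists_periodic_trajectories
    {F₁ F₂ : ℝ × ℝ × ℝ × ℝ × ℝ → ℝ} (hF₁ : ContDiff ℝ 1 F₁) (hF₂ : ContDiff ℝ 1 F₂)
    {p : ℕ} (hp : 0 < p)
    (hper₁ : ∀ (t : ℝ) (v : ℝ × ℝ × ℝ × ℝ), F₁ (t + p * slowPeriod, v) = F₁ (t, v))
    (hper₂ : ∀ (t : ℝ) (v : ℝ × ℝ × ℝ × ℝ), F₂ (t + p * slowPeriod, v) = F₂ (t, v))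
    {X Y : ℝ} (hzero : IsSimpleZero F₁ F₂ p X Y) :
    ∃ ε₀ : ℝ, 0 < ε₀ ∧ ∃ y : ℝ → ℝ → ℝ × ℝ × ℝ × ℝ,
      (∀ ε : ℝ, ε ≠ 0 → |ε| < ε₀ → Function.Periodic (y ε) (p * slowPeriod) ∧
        ∀ t, HasDerivAt (y ε) (pendulumField F₁ F₂ ε t (y ε t)) t) ∧
      TendstoUniformly y (fun t => (A X Y t, B X Y t, C X Y t, D X Y t)) (𝓝[≠] 0) := by
  have hT : 0 < p * slowPeriod := mul_pos (by exact_mod_cast hp) slowPeriod_pos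
  have hK := contDiff_ampField hF₁ hF₂
  have hK' : Continuous (Function.uncurry fun t => fderiv ℝ (ampField F₁ F₂ t)) := by
    have h := ContDiff.fderiv (n := 0) (m := 1)
      (f := fun z : ℝ × ((ℝ × ℝ) × (ℝ × ℝ)) => ampField F₁ F₂ z.1) (g := fun z => z.2)
      (hK.comp (f := fun z : (ℝ × ((ℝ × ℝ) × (ℝ × ℝ))) × ((ℝ × ℝ) × (ℝ × ℝ)) => (z.1.1, z.2))
        (by fun_prop)) contDiff_snd (zero_add 1).le
    exact h.continuous
  have hd : ∀ t v, HasFDerivAt (ampField F₁ F₂ t) (fderiv ℝ (ampField F₁ F₂ t) v) v := fun t v =>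
    (((hK.comp (f := fun v : (ℝ × ℝ) × (ℝ × ℝ) => (t, v)) (by fun_prop)).differentiable
      one_ne_zero) v).hasFDerivAt
  obtain ⟨hz₁, hz₂, hdet⟩ := hzero
  obtain ⟨hG, hGb⟩ := hasFDerivAt_of_det_ne_zero hdet
  -- The factors `-1/2` and `1/2` relating `(𝒢₁, 𝒢₂)` to the averaged slow field.
  let Q : ℝ × ℝ →L[ℝ] ℝ × ℝ := ((-1 / 2 : ℝ) • ContinuousLinearMap.fst ℝ ℝ ℝ).prod
    ((1 / 2 : ℝ) • ContinuousLinearMap.snd ℝ ℝ ℝ)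
  have hQ : Function.Bijective Q := by
    refine ⟨fun a b hab => ?_, fun b => ⟨(-2 * b.1, 2 * b.2), ?_⟩⟩
    · have h1 : -1 / 2 * a.1 = -1 / 2 * b.1 := congrArg Prod.fst hab
      have h2 : 1 / 2 * a.2 = 1 / 2 * b.2 := congrArg Prod.snd hab
      ext <;> linarith
    · ext <;> simp [Q]
      ring
  obtain ⟨ε₀, hε₀, Φ, hΦ, hlim⟩ := exists_amplitudes hT (ampField F₁ F₂)
    (fun t => fderiv ℝ (ampField F₁ F₂ t)) hK.continuous hK' hd
    (rotationSubId (Real.cos (fastFreq * (p * slowPeriod)))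
      (Real.sin (fastFreq * (p * slowPeriod))))
    (rotationSubId_bijective _ (cos_fastFreq_ne_one hp)) (X, Y)
    (by rw [integral_ampField_fst hF₁.continuous hF₂.continuous, hz₁, hz₂]; simp)
    (Q ∘L _) (hQ.comp hGb)
    (by
      simp only [integral_ampField_fst hF₁.continuous hF₂.continuous]
      exact Q.hasFDerivAt.comp (X, Y) hG)
  have hex : ∀ ε, ∃ y : ℝ → ℝ × ℝ × ℝ × ℝ, ε ≠ 0 → |ε| < ε₀ →
      Function.Periodic y (p * slowPeriod) ∧
        (∀ t, HasDerivAt y (pendulumField F₁ F₂ ε t (y t)) t) ∧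
        ∀ t ∈ Set.Icc 0 (p * slowPeriod), y t = phase t (Φ ε t) := by
    intro ε
    by_cases h : ε ≠ 0 ∧ |ε| < ε₀
    · obtain ⟨h1, h2, h3⟩ := hΦ ε h.1 h.2
      obtain ⟨y, hy⟩ := exists_periodic_extension hT
        (continuous_pendulumField hF₁.continuous hF₂.continuous ε)
        (fun t x => by simp only [pendulumField, hper₁, hper₂])
        (fun t ht => hasDerivAt_phase (h1 t ht)) (phase_zero_eq_phase_period h2 h3)
      exact ⟨y, fun _ _ => hy⟩
    · exact ⟨0, fun h1 h2 => (h ⟨h1, h2⟩).elim⟩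
  choose y hy using hex
  refine ⟨ε₀, hε₀, y, fun ε h1 h2 => ⟨(hy ε h1 h2).1, (hy ε h1 h2).2.1⟩, ?_⟩
  rw [Metric.tendstoUniformly_iff]
  intro η hη
  have hball : ∀ᶠ ε in 𝓝 (0 : ℝ), ε ∈ Metric.ball (0 : ℝ) ε₀ := Metric.ball_mem_nhds _ hε₀
  filter_upwards [hlim (η / 8) (by positivity), hball.filter_mono nhdsWithin_le_nhds,
    self_mem_nhdsWithin] with ε h1 h2 h3 t
  obtain ⟨k1, -, k3⟩ := hy ε h3 (by simpa using h2)
  have hT' : freq * (p * slowPeriod) = (p : ℤ) * (2 * Real.pi) := by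
    rw [← freq_mul_slowPeriod]
    push_cast
    ring
  -- Limit and solution share the period `p T₁`, so their distance need only be bounded on `[0, p
  -- T₁]`; there `η / 8` absorbs the constant of `norm_phase_le`.
  have hdp : Function.Periodic (fun t =>
      dist (A X Y t, B X Y t, C X Y t, D X Y t) (y ε t)) (p * slowPeriod) := fun t => by
    simp only [k1 t, slow_periodic hT' X Y t]
  obtain ⟨s, hs, hst⟩ := hdp.exists_mem_Ico₀ hT t
  refine hst.trans_lt ?_
  have hs' : s ∈ Set.Icc 0 (p * slowPeriod) := ⟨hs.1, hs.2.le⟩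
  rw [dist_comm, k3 s hs', ← phase_slow, dist_eq_norm, phase_sub]
  linarith [norm_phase_le s (Φ ε s - ((X, Y), 0)), h1 s hs']

end DoublePendulum

theorem theorem1
    (F₁ F₂ : ℝ × ℝ × ℝ × ℝ × ℝ → ℝ) (hF₁ : ContDiff ℝ 2 F₁) (hF₂ : ContDiff ℝ 2 F₂)
    (p q : ℕ) (hp : 0 < p) (hq : 0 < q) (hpq : Nat.Coprime p q)
    (hper₁ : ∀ (τ : ℝ) (v : ℝ × ℝ × ℝ × ℝ),
      F₁ (τ + p * DoublePendulum.slowPeriod / q, v) = F₁ (τ, v))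
    (hper₂ : ∀ (τ : ℝ) (v : ℝ × ℝ × ℝ × ℝ),
      F₂ (τ + p * DoublePendulum.slowPeriod / q, v) = F₂ (τ, v))
    (X Y : ℝ) (hXY : (X, Y) ≠ (0, 0)) (hzero : DoublePendulum.IsSimpleZero F₁ F₂ p X Y) :
    -- the limit is a solution of the unperturbed pendulum whose minimal period is `T₁`
    (DoublePendulum.IsSolution F₁ F₂ 0 (DoublePendulum.A X Y) (DoublePendulum.C X Y) ∧
      IsLeast {S : ℝ | 0 < S ∧ Function.Periodic (DoublePendulum.A X Y) S ∧
        Function.Periodic (DoublePendulum.C X Y) S} DoublePendulum.slowPeriod) ∧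
    ∃ ε₀ : ℝ, 0 < ε₀ ∧ ∃ θ₁ θ₂ : ℝ → ℝ → ℝ,
      (∀ ε : ℝ, ε ≠ 0 → |ε| < ε₀ →
        DoublePendulum.IsSolution F₁ F₂ ε (θ₁ ε) (θ₂ ε) ∧
        Function.Periodic (θ₁ ε) (p * DoublePendulum.slowPeriod) ∧
        Function.Periodic (θ₂ ε) (p * DoublePendulum.slowPeriod)) ∧
      -- convergence in the phase space, uniformly in time
      TendstoUniformly θ₁ (DoublePendulum.A X Y) (𝓝[≠] 0) ∧
      TendstoUniformly (fun ε => deriv (θ₁ ε)) (DoublePendulum.B X Y) (𝓝[≠] 0) ∧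
      TendstoUniformly θ₂ (DoublePendulum.C X Y) (𝓝[≠] 0) ∧
      TendstoUniformly (fun ε => deriv (θ₂ ε)) (DoublePendulum.D X Y) (𝓝[≠] 0) := by
  refine ⟨⟨DoublePendulum.isSolution_slow F₁ F₂ X Y, DoublePendulum.isLeast_slowPeriod hXY⟩, ?_⟩
  have hq' : (q : ℝ) ≠ 0 := by exact_mod_cast hq.ne'
  -- `q` periods of length `p T₁ / q` make up `p T₁`.
  have hmul : ∀ F : ℝ × ℝ × ℝ × ℝ × ℝ → ℝ, (∀ (τ : ℝ) (v : ℝ × ℝ × ℝ × ℝ),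
      F (τ + p * DoublePendulum.slowPeriod / q, v) = F (τ, v)) →
      ∀ (τ : ℝ) (v : ℝ × ℝ × ℝ × ℝ), F (τ + p * DoublePendulum.slowPeriod, v) = F (τ, v) := by
    intro F hF τ v
    have h1 : Function.Periodic (fun τ => F (τ, v)) (p * DoublePendulum.slowPeriod / q) :=
      fun τ => hF τ v
    have h2 := h1.nat_mul q τ
    rwa [mul_div_cancel₀ _ hq'] at h2
  obtain ⟨ε₀, hε₀, y, hy, hlim⟩ := DoublePendulum.exists_periodic_trajectories
    (hF₁.of_le one_le_two) (hF₂.of_le one_le_two) hp (hmul F₁ hper₁) (hmul F₂ hper₂) hzero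
  have hball : ∀ᶠ ε in 𝓝 (0 : ℝ), ε ∈ Metric.ball (0 : ℝ) ε₀ := Metric.ball_mem_nhds _ hε₀
  have hev : ∀ᶠ ε in 𝓝[≠] (0 : ℝ), ε ≠ 0 ∧ |ε| < ε₀ := by
    filter_upwards [hball.filter_mono nhdsWithin_le_nhds, self_mem_nhdsWithin] with ε h1 h2
    exact ⟨h2, by simpa using h1⟩
  have hproj : ∀ φ : ℝ × ℝ × ℝ × ℝ →L[ℝ] ℝ, TendstoUniformly (fun ε t => φ (y ε t))
      (fun t => φ (DoublePendulum.A X Y t, DoublePendulum.B X Y t, DoublePendulum.C X Y t,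
        DoublePendulum.D X Y t)) (𝓝[≠] 0) := fun φ =>
    φ.uniformContinuous.comp_tendstoUniformly hlim
  let π₁ := ContinuousLinearMap.fst ℝ ℝ (ℝ × ℝ × ℝ)
  let π₂ := ContinuousLinearMap.fst ℝ ℝ (ℝ × ℝ) ∘L ContinuousLinearMap.snd ℝ ℝ (ℝ × ℝ × ℝ)
  let π₃₄ := ContinuousLinearMap.snd ℝ ℝ (ℝ × ℝ) ∘L ContinuousLinearMap.snd ℝ ℝ (ℝ × ℝ × ℝ)
  refine ⟨ε₀, hε₀, fun ε t => (y ε t).1, fun ε t => (y ε t).2.2.1, fun ε h1 h2 => ?_,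
    hproj π₁, ?_, hproj (ContinuousLinearMap.fst ℝ ℝ ℝ ∘L π₃₄), ?_⟩
  · obtain ⟨hper, hd⟩ := hy ε h1 h2
    exact ⟨(DoublePendulum.isSolution_of_hasDerivAt hd).1,
      fun t => congrArg (fun u => u.1) (hper t), fun t => congrArg (fun u => u.2.2.1) (hper t)⟩
  -- The second component of `y ε` is the derivative of the first only where `y ε` solves the
  -- system, that is, for small nonzero `ε`.
  · refine (tendstoUniformly_congr ?_).1 (hproj π₂)
    filter_upwards [hev] with ε hε
    exact (DoublePendulum.isSolution_of_hasDerivAt (hy ε hε.1 hε.2).2).2.1.symm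
  · refine (tendstoUniformly_congr ?_).1 (hproj (ContinuousLinearMap.snd ℝ ℝ ℝ ∘L π₃₄))
    filter_upwards [hev] with ε hε
    exact (DoublePendulum.isSolution_of_hasDerivAt (hy ε hε.1 hε.2).2).2.2.symm
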